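/- For $n\ge 1$ let $Y_n=(y_{i,j})_{i,j=1}^n$ be a random matrix whose entries are independent standard normal variables (the probability space being $\mathbb R^{n^2}$ with the standard Gaussian measure). Let $U_n$ be the $n\times n$ matrix whose columns $\nu_1,\dots,\nu_n$ are obtained by applying the Gram–Schmidt orthonormalization procedure to the columns $y_1,\dots,y_n$ of $Y_n$, in this order (they are almost surely linearly independent). For $0\le m\le n$ and $1\le i\le n$ let $F_i^m\in\mathbb R^m$ be the vector formed by the first $m$ coordinates of the $i$-th row of $Y_n-\sqrt n\,U_n$, and let $\|\cdot\|$ be the Euclidean norm. There are constants $k>0$ and $C>0$ such that the following holds. For every $n$ choose $m=m(n)\in\mathbb N$ with $0\le m\le n$ so that $\alpha_n=\frac mn\to 0$ as $n\to\infty$. Then there is a deterministic sequence $r_n=o\!\left(\frac{m}{\sqrt n}\right)$ such that for every $n\ge 1$ $$\sup_{1\le i\le n}\|F_i^m\|\le \frac{m}{\sqrt{2n}}+r_n\quad\text{with probability greater than } 1-Cne^{-m^k},$$ and $$\inf_{1\le i\le n}\|F_i^m\|\ge \frac{m}{\sqrt{2n}}-r_n\quad\text{with probability greater than } 1-Cne^{-m^k}.$$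 Moreover, for every such choice of $m=m(n)$, $\sup_{1\le i\le n}\|F_i^m\|\to 0$ in probability as $n\to\infty$ if and only if $m=o(\sqrt n)$. -/

import Mathlib

open Asymptotics Filter Topology MeasureTheory ProbabilityTheory

noncomputable section

namespace GaussianGramSchmidt

/-- A sample point of `ℝ^(n²)`, given by the columns `ω 1, …, ω n` of an `n × n` real matrix:
`ω j i` is the entry `y_{i,j}` in row `i` and column `j`. -/
abbrev Sample (n : ℕ) : Type := Fin n → Fin n → ℝ

/-- The standard Gaussian measure on `ℝ^(n²)`: the entries are independent standard normals. -/
def gaussianMeasure (n : ℕ) : Measure (Sample n) :=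
  Measure.pi fun _ : Fin n => Measure.pi fun _ : Fin n => gaussianReal 0 1

/-- The Gaussian random matrix `Y_n`. -/
def Y {n : ℕ} (ω : Sample n) : Matrix (Fin n) (Fin n) ℝ :=
  Matrix.of fun i j => ω j i

/-- The `j`-th column of `Y_n`, as a vector of Euclidean space. -/
def column {n : ℕ} (ω : Sample n) (j : Fin n) : EuclideanSpace ℝ (Fin n) :=
  WithLp.toLp 2 fun i => Y ω i j

/-- The matrix `U_n` whose columns are obtained from those of `Y_n`, in order from the first to the
last, by the Gram-Schmidt orthonormalization procedure. (It is orthogonal whenever the columns of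
`Y_n` are linearly independent, hence almost surely.) -/
def U {n : ℕ} (ω : Sample n) : Matrix (Fin n) (Fin n) ℝ :=
  Matrix.of fun i j => InnerProductSpace.gramSchmidtNormed ℝ (column ω) j i

/-- `F_i^m`: the vector formed by the first `m` coordinates of the `i`-th row of `Y_n - √n U_n`. -/
def F {n : ℕ} (m : ℕ) (ω : Sample n) (i : Fin n) : EuclideanSpace ℝ {j : Fin n // (j : ℕ) < m} :=
  WithLp.toLp 2 fun j => (Y ω - √(n : ℝ) • U ω) i j

/-- The largest Euclidean norm `sup_i ‖F_i^m‖`. -/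
def supF {n : ℕ} (m : ℕ) (ω : Sample n) : ℝ := ⨆ i : Fin n, ‖F m ω i‖

/-- The smallest Euclidean norm `inf_i ‖F_i^m‖`. -/
def infF {n : ℕ} (m : ℕ) (ω : Sample n) : ℝ := ⨅ i : Fin n, ‖F m ω i‖

end GaussianGramSchmidt

end

/-!
Let `y j` be the columns of `Y`, let `P j` be the orthogonal projection to the span of the columns
before `y j`, and let `w j = y j - P j (y j)`, so that the columns of `U` are `w j / ‖w j‖`. Fix a row
`i` with basis vector `e`. The entry of `Y - √n U` in column `j` is

  `a j + b j * (1 - √n / ‖w j‖)`,  `a j = ⟪y j, P j e⟫`,  `b j = ⟪y j, e - P j e⟫`.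

Given the previous columns, `a j` and `b j` are centered Gaussian variables with variances `p j` and
`1 - p j`, where `p j = ‖P j e‖ ^ 2 = ∑ l < j, b l ^ 2 / ‖w l‖ ^ 2`. Since `‖w l‖ ^ 2` is close to `n`
and the sum of the `b l ^ 2` is close to the number of its terms, `p j` is close to `j / n`; hence
`∑ j < m, a j ^ 2` is close to `m ^ 2 / (2 * n)`. The second term of the entry is negligible because
`‖w j‖ ^ 2` differs from `n` by a small multiple of `√(n * m)` only. This is the deterministic part,
`RowEstimates.abs_norm_sub_le`.

The closeness holds up to probability `O(m * exp (-c * m))` for each row, with `c` depending on the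
accuracy. The sums of `a j ^ 2 - p j` and `b j ^ 2 - (1 - p j)` obey a Bernstein inequality for
nonanticipating sums on a product space, `measure_le_abs_sum_below_le`, which rests on resampling one
column at a time. The length of `P j (y j)` is controlled by the rotation invariance of the Gaussian
measure, `gaussianVector_sum_inner_sq_le`. A union bound over the rows gives
`measure_exists_row_le`.

With `k = 1 / 2` and `C = 1`, the claimed probability bound is void unless `m ≥ (log n) ^ 2`, and in
that case `m * exp (-c * m)` is eventually much smaller than `exp (-√m)`. So every fixed multiple of
`m / √n` is eventually an admissible deviation, and the least admissible deviations are
`o(m / √n)`. The criterion for convergence in probability follows, using that the row norms increase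
with `m`.
-/

namespace GaussianGramSchmidt

/-! ### Exponential moments of squares of Gaussian variables -/

theorem exp_neg_mul_inv_sqrt_le {x : ℝ} (hx : |x| ≤ 1 / 4) :
    Real.exp (-x) * (√(1 - 2 * x))⁻¹ ≤ Real.exp (4 * x ^ 2) := by
  obtain ⟨h1, h2⟩ := abs_le.1 hx
  have hpos : 0 < 1 - 2 * x := by linarith
  have hlog : -(2 * x + 8 * x ^ 2) ≤ Real.log (1 - 2 * x) := by
    refine le_trans ?_ (Real.one_sub_inv_le_log_of_pos hpos)
    rw [← sub_nonneg]
    have : 1 - (1 - 2 * x)⁻¹ - -(2 * x + 8 * x ^ 2) = 4 * x ^ 2 * (1 - 4 * x) / (1 - 2 * x) := by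
      field_simp; ring
    rw [this]
    apply div_nonneg _ hpos.le
    apply mul_nonneg (by positivity); linarith
  rw [Real.sqrt_eq_rpow, Real.rpow_def_of_pos hpos, ← Real.exp_neg, ← Real.exp_add]
  apply Real.exp_le_exp.2
  nlinarith

theorem lintegral_exp_sq_gaussianReal {x : ℝ} (hx : |x| ≤ 1 / 4) :
    ∫⁻ g, ENNReal.ofReal (Real.exp (x * (g ^ 2 - 1))) ∂gaussianReal 0 1 ≤
      ENNReal.ofReal (Real.exp (4 * x ^ 2)) := by
  obtain ⟨h1, h2⟩ := abs_le.1 hx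
  rw [gaussianReal_of_var_ne_zero 0 one_ne_zero,
    lintegral_withDensity_eq_lintegral_mul _ (measurable_gaussianPDF 0 1) (by fun_prop)]
  have hf : ∀ g : ℝ, (gaussianPDF 0 1 * fun g => ENNReal.ofReal (Real.exp (x * (g ^ 2 - 1)))) g
      = ENNReal.ofReal ((√(2 * Real.pi))⁻¹ * Real.exp (-x) * Real.exp (-(1 / 2 - x) * g ^ 2)) := by
    intro g
    rw [Pi.mul_apply, gaussianPDF, ← ENNReal.ofReal_mul (gaussianPDFReal_nonneg 0 1 g),
      gaussianPDFReal]
    simp only [NNReal.coe_one, mul_one, sub_zero]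
    rw [mul_assoc, mul_assoc, ← Real.exp_add, ← Real.exp_add]
    ring_nf
  simp_rw [hf]
  rw [← ofReal_integral_eq_lintegral_ofReal
    ((integrable_exp_neg_mul_sq (by linarith)).const_mul _)
    (Filter.Eventually.of_forall fun g => by positivity), integral_const_mul, integral_gaussian]
  apply ENNReal.ofReal_le_ofReal
  refine le_trans (le_of_eq ?_) (exp_neg_mul_inv_sqrt_le hx)
  have e : Real.pi / (1 / 2 - x) = (2 * Real.pi) / (1 - 2 * x) := by
    have : 1 - 2 * x ≠ 0 := by linarith
    have : 1 / 2 - x ≠ 0 := by linarith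
    field_simp
  rw [e, Real.sqrt_div (by positivity)]
  have : √(2 * Real.pi) ≠ 0 := by positivity
  field_simp

/-- The standard Gaussian measure on `ℝⁿ`. -/
noncomputable abbrev gaussianVector (n : ℕ) : Measure (Fin n → ℝ) :=
  Measure.pi fun _ => gaussianReal 0 1

theorem map_inner_gaussianVector {n : ℕ} (u : EuclideanSpace ℝ (Fin n)) :
    (gaussianVector n).map (fun y => inner ℝ (WithLp.toLp 2 y) u) =
      (gaussianReal 0 1).map (fun g => ‖u‖ * g) := by
  have h1 : (fun y : Fin n → ℝ => inner ℝ (WithLp.toLp 2 y) u) =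
      (innerSL ℝ u) ∘ (WithLp.toLp 2) := by
    ext y; simp [real_inner_comm]
  rw [h1, ← Measure.map_map (by fun_prop) (by fun_prop), map_pi_eq_stdGaussian,
    IsGaussian.map_eq_gaussianReal, integral_strongDual_stdGaussian, variance_dual_stdGaussian,
    gaussianReal_map_const_mul]
  simp only [mul_zero, innerSL_apply_norm, mul_one]
  congr 1
  ext; simp

theorem lintegral_exp_inner_sq {n : ℕ} (u : EuclideanSpace ℝ (Fin n)) {x s : ℝ}
    (hs : ‖u‖ ^ 2 ≤ s) (hx : |x| * s ≤ 1 / 4) :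
    ∫⁻ y, ENNReal.ofReal (Real.exp (x * (inner ℝ (WithLp.toLp 2 y) u ^ 2 - ‖u‖ ^ 2)))
      ∂gaussianVector n ≤ ENNReal.ofReal (Real.exp (4 * (x * s) ^ 2)) := by
  have h0 : ∫⁻ y, ENNReal.ofReal (Real.exp (x * (inner ℝ (WithLp.toLp 2 y) u ^ 2 - ‖u‖ ^ 2)))
      ∂gaussianVector n = ∫⁻ z, ENNReal.ofReal (Real.exp (x * (z ^ 2 - ‖u‖ ^ 2)))
        ∂((gaussianVector n).map (fun y => inner ℝ (WithLp.toLp 2 y) u)) := by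
    rw [lintegral_map (by fun_prop) (by fun_prop)]
  rw [h0, map_inner_gaussianVector, lintegral_map (by fun_prop) (by fun_prop)]
  have h1 : |x * ‖u‖ ^ 2| ≤ |x| * s := by
    rw [abs_mul, abs_of_nonneg (sq_nonneg ‖u‖)]; gcongr
  have := lintegral_exp_sq_gaussianReal (h1.trans hx)
  calc _ = ∫⁻ g, ENNReal.ofReal (Real.exp (x * ‖u‖ ^ 2 * (g ^ 2 - 1))) ∂gaussianReal 0 1 := by
        congr with g; ring_nf
    _ ≤ _ := this
    _ ≤ _ := by
        apply ENNReal.ofReal_le_ofReal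
        have h2 : (x * ‖u‖ ^ 2) ^ 2 ≤ (x * s) ^ 2 := by
          apply sq_le_sq.2
          rw [abs_mul x s, abs_of_nonneg ((sq_nonneg ‖u‖).trans hs)]
          exact h1
        gcongr

/-! ### Concentration of nonanticipating sums on product spaces -/

section Product

variable {E : Type*} [MeasurableSpace E] (γ : Measure E) [IsProbabilityMeasure γ] {n : ℕ}

/-- Resampling one coordinate does not change an integral over a product probability space. -/
theorem lintegral_pi_update {f : (Fin n → E) → ENNReal} (hf : Measurable f) (j : Fin n) :
    ∫⁻ ω, f ω ∂Measure.pi (fun _ => γ) =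
      ∫⁻ ω, ∫⁻ y, f (Function.update ω j y) ∂γ ∂Measure.pi (fun _ => γ) := by
  have hg : (fun ω => ∫⁻ y, f (Function.update ω j y) ∂γ) =
      lmarginal (fun _ : Fin n => γ) {j} f := by
    rw [lmarginal_singleton]
  have hm : Measurable (fun ω => ∫⁻ y, f (Function.update ω j y) ∂γ) := by
    rw [hg]; exact hf.lmarginal _
  refine lintegral_eq_of_lmarginal_eq {j} hf hm ?_
  rw [lmarginal_singleton, lmarginal_singleton]
  ext ω
  simp

/-- The indices of `Fin n` below `k`. -/
def below (n k : ℕ) : Finset (Fin n) := Finset.univ.filter fun l => (l : ℕ) < k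

@[simp] theorem mem_below {k : ℕ} {l : Fin n} : l ∈ below n k ↔ (l : ℕ) < k := by simp [below]

@[simp] theorem below_zero : below n 0 = ∅ := by ext; simp

theorem below_succ {k : ℕ} (hk : k < n) : below n (k + 1) = insert ⟨k, hk⟩ (below n k) := by
  ext l; simp [Fin.ext_iff]; omega

theorem below_eq_univ {k : ℕ} (hk : n ≤ k) : below n k = Finset.univ := by
  ext l; simp; omega

theorem notMem_below_self {k : ℕ} (hk : k < n) : (⟨k, hk⟩ : Fin n) ∉ below n k := by simp

theorem card_below {k : ℕ} (hk : k ≤ n) : (below n k).card = k := by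
  induction k with
  | zero => simp
  | succ k ih =>
    rw [below_succ (by omega), Finset.card_insert_of_notMem (notMem_below_self _), ih (by omega)]

/-- Each `D l` depends only on the coordinates up to `l`. -/
def Nonanticipating {β : Type*} (D : Fin n → (Fin n → E) → β) : Prop :=
  ∀ (l j : Fin n), l < j → ∀ ω y, D l (Function.update ω j y) = D l ω

/-- Integrating out the coordinates from the last to the first, each factor contributes at most
`c`. -/
theorem lintegral_prod_below_le {V : Fin n → (Fin n → E) → ENNReal} (hV : ∀ j, Measurable (V j))
    (hA : Nonanticipating V) {c : ENNReal}
    (hc : ∀ j ω, ∫⁻ y, V j (Function.update ω j y) ∂γ ≤ c) {k : ℕ} (hk : k ≤ n) :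
    ∫⁻ ω, ∏ j ∈ below n k, V j ω ∂Measure.pi (fun _ => γ) ≤ c ^ k := by
  induction k with
  | zero => simp
  | succ k ih =>
    have hkn : k < n := by omega
    rw [lintegral_pi_update γ (by fun_prop) ⟨k, hkn⟩]
    calc _ = ∫⁻ ω, ∫⁻ y, V ⟨k, hkn⟩ (Function.update ω ⟨k, hkn⟩ y) *
          ∏ j ∈ below n k, V j ω ∂γ ∂Measure.pi (fun _ => γ) := by
          congr with ω
          congr with y
          rw [below_succ hkn, Finset.prod_insert (notMem_below_self _)]
          congr 1
          exact Finset.prod_congr rfl fun l hl => hA l _ (by simpa [Fin.lt_def] using hl) ω y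
      _ ≤ ∫⁻ ω, c * ∏ j ∈ below n k, V j ω ∂Measure.pi (fun _ => γ) := by
          refine lintegral_mono fun ω => ?_
          rw [lintegral_mul_const _ (f := fun y => V ⟨k, hkn⟩ (Function.update ω ⟨k, hkn⟩ y))
            ((hV _).comp (measurable_update ω))]
          gcongr
          exact hc _ _
      _ ≤ c ^ (k + 1) := by
          rw [lintegral_const_mul _ (by fun_prop), pow_succ']
          gcongr
          exact ih (by omega)

variable {γ}

theorem measure_le_sum_below_le {D : Fin n → (Fin n → E) → ℝ} (hD : ∀ j, Measurable (D j))
    (hA : Nonanticipating D) {x c : ℝ}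
    (hx : ∀ j ω, ∫⁻ y, ENNReal.ofReal (Real.exp (x * D j (Function.update ω j y))) ∂γ ≤
      ENNReal.ofReal (Real.exp c)) {k : ℕ} (hk : k ≤ n) (t : ℝ) :
    Measure.pi (fun _ : Fin n => γ) {ω | t ≤ x * ∑ j ∈ below n k, D j ω} ≤
      ENNReal.ofReal (Real.exp (k * c - t)) := by
  have h1 := lintegral_prod_below_le γ (V := fun j ω => ENNReal.ofReal (Real.exp (x * D j ω)))
    (fun j => by have := hD j; fun_prop) (fun l j hl ω y => by simp only [hA l j hl ω y]) hx hk
  have h2 : ∀ ω, ∏ j ∈ below n k, ENNReal.ofReal (Real.exp (x * D j ω)) =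
      ENNReal.ofReal (Real.exp (x * ∑ j ∈ below n k, D j ω)) := by
    intro ω
    rw [← ENNReal.ofReal_prod_of_nonneg fun _ _ => (Real.exp_pos _).le, ← Real.exp_sum,
      Finset.mul_sum]
  simp_rw [h2] at h1
  have h3 := meas_ge_le_lintegral_div (μ := Measure.pi (fun _ : Fin n => γ))
    (f := fun ω => ENNReal.ofReal (Real.exp (x * ∑ j ∈ below n k, D j ω)))
    (Measurable.aemeasurable (by fun_prop)) (ε := ENNReal.ofReal (Real.exp t))
    (by simp [Real.exp_pos]) ENNReal.ofReal_ne_top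
  calc _ ≤ _ := measure_mono (fun ω (hω : t ≤ _) => by
        exact ENNReal.ofReal_le_ofReal (Real.exp_le_exp.2 hω))
    _ ≤ _ := h3
    _ ≤ ENNReal.ofReal (Real.exp c) ^ k / ENNReal.ofReal (Real.exp t) := by gcongr
    _ = _ := by
      rw [← ENNReal.ofReal_pow (Real.exp_pos _).le, ← ENNReal.ofReal_div_of_pos (Real.exp_pos _),
        ← Real.exp_nat_mul, ← Real.exp_sub]

/-- A Bernstein inequality: the increments `D j` are conditionally subexponential at scale `s`, given
the coordinates before `j`. -/
theorem measure_le_abs_sum_below_le {D : Fin n → (Fin n → E) → ℝ} (hD : ∀ j, Measurable (D j))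
    (hA : Nonanticipating D) {s : ℝ} (hs : 0 < s)
    (hx : ∀ x, |x| * s ≤ 1 / 4 → ∀ j ω,
      ∫⁻ y, ENNReal.ofReal (Real.exp (x * D j (Function.update ω j y))) ∂γ ≤
        ENNReal.ofReal (Real.exp (4 * (x * s) ^ 2))) {k K : ℕ} (hk : k ≤ n) (hkK : k ≤ K)
    (hK : 0 < K) {t : ℝ} (ht : 0 ≤ t) (htK : t ≤ 2 * K * s) :
    Measure.pi (fun _ : Fin n => γ) {ω | t ≤ |∑ j ∈ below n k, D j ω|} ≤
      ENNReal.ofReal (2 * Real.exp (-(t ^ 2 / (16 * K * s ^ 2)))) := by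
  have hK' : (0 : ℝ) < K := by exact_mod_cast hK
  -- This choice minimizes `4 * K * (x * s) ^ 2 - x * t`.
  set x : ℝ := t / (8 * K * s ^ 2) with hxdef
  have hx0 : 0 ≤ x := by positivity
  have hxs : |x| * s ≤ 1 / 4 := by
    rw [abs_of_nonneg hx0, hxdef, div_mul_eq_mul_div, div_le_iff₀ (by positivity)]
    nlinarith
  have key : ∀ z : ℝ, |z| = x → Measure.pi (fun _ : Fin n => γ)
      {ω | x * t ≤ z * ∑ j ∈ below n k, D j ω} ≤
        ENNReal.ofReal (Real.exp (-(t ^ 2 / (16 * K * s ^ 2)))) := by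
    intro z hz
    refine (measure_le_sum_below_le hD hA (hx z (by rw [hz, ← abs_of_nonneg hx0]; exact hxs))
      hk _).trans ?_
    apply ENNReal.ofReal_le_ofReal
    apply Real.exp_le_exp.2
    have hz2 : z ^ 2 = x ^ 2 := by rw [← sq_abs, hz]
    calc (k : ℝ) * (4 * (z * s) ^ 2) - x * t ≤ K * (4 * (z * s) ^ 2) - x * t := by gcongr
      _ = _ := by
        rw [mul_pow, hz2, hxdef]; field_simp; ring
  calc _ ≤ Measure.pi (fun _ : Fin n => γ) ({ω | x * t ≤ x * ∑ j ∈ below n k, D j ω} ∪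
        {ω | x * t ≤ (-x) * ∑ j ∈ below n k, D j ω}) := by
        refine measure_mono fun ω (hω : t ≤ |_|) => ?_
        rcases le_abs.1 hω with h | h
        · left; exact mul_le_mul_of_nonneg_left h hx0
        · right
          change x * t ≤ -x * _
          rw [neg_mul, ← mul_neg]; exact mul_le_mul_of_nonneg_left h hx0
    _ ≤ _ := measure_union_le _ _
    _ ≤ _ := add_le_add (key x (abs_of_nonneg hx0)) (key (-x) (by rw [abs_neg, abs_of_nonneg hx0]))
    _ = _ := by
      rw [← ENNReal.ofReal_add (by positivity) (by positivity), two_mul]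

/-- An event has small probability if it does so conditionally on all the coordinates but one. -/
theorem measure_pi_le_of_update {A : Set (Fin n → E)} (hA : MeasurableSet A) (j : Fin n)
    {c : ENNReal} (h : ∀ ω, γ {y | Function.update ω j y ∈ A} ≤ c) :
    Measure.pi (fun _ : Fin n => γ) A ≤ c := by
  rw [← lintegral_indicator_one hA, lintegral_pi_update γ (measurable_one.indicator hA) j]
  calc _ ≤ ∫⁻ _, c ∂Measure.pi (fun _ : Fin n => γ) := by
        refine lintegral_mono fun ω => ?_
        exact le_trans (le_of_eq (lintegral_indicator_one (measurable_update ω hA))) (h ω)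
    _ = c := by simp

end Product

/-! ### Gram-Schmidt projections of the columns -/

section GramSchmidt

open InnerProductSpace

variable {n : ℕ} {V : Type*} [NormedAddCommGroup V] [InnerProductSpace ℝ V]

theorem inner_gramSchmidtNormed_of_ne (f : Fin n → V) {l l' : Fin n} (h : l ≠ l') :
    inner ℝ (gramSchmidtNormed ℝ f l) (gramSchmidtNormed ℝ f l') = 0 := by
  simp [gramSchmidtNormed, inner_smul_left, inner_smul_right, gramSchmidt_orthogonal ℝ f h]

/-- Each vector of the orthonormalized family is a unit vector or zero. -/
theorem inner_gramSchmidtNormed_self_smul (f : Fin n → V) (l : Fin n) :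
    inner ℝ (gramSchmidtNormed ℝ f l) (gramSchmidtNormed ℝ f l) • gramSchmidtNormed ℝ f l =
      gramSchmidtNormed ℝ f l := by
  by_cases h : gramSchmidtNormed ℝ f l = 0
  · simp [h]
  · rw [real_inner_self_eq_norm_sq, gramSchmidtNormed_unit_length' h]; simp

/-- The orthogonal projection of `v` to the span of the first `k` vectors of `f`, written in the
orthonormalized family. Some of its members vanish if the vectors are linearly dependent, which does
no harm to the formula. -/
noncomputable def prevProj (f : Fin n → V) (k : ℕ) (v : V) : V :=
  ∑ l ∈ below n k, inner ℝ (gramSchmidtNormed ℝ f l) v • gramSchmidtNormed ℝ f l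

theorem inner_prevProj (f : Fin n → V) (k : ℕ) (u v : V) :
    inner ℝ u (prevProj f k v) = ∑ l ∈ below n k,
      inner ℝ (gramSchmidtNormed ℝ f l) u * inner ℝ (gramSchmidtNormed ℝ f l) v := by
  simp only [prevProj, inner_sum, inner_smul_right]
  exact Finset.sum_congr rfl fun l _ => by rw [real_inner_comm u, mul_comm]

theorem inner_prevProj_comm (f : Fin n → V) (k : ℕ) (u v : V) :
    inner ℝ u (prevProj f k v) = inner ℝ (prevProj f k u) v := by
  rw [real_inner_comm v (prevProj f k u), inner_prevProj, inner_prevProj]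
  exact Finset.sum_congr rfl fun l _ => mul_comm _ _

theorem prevProj_prevProj (f : Fin n → V) (k : ℕ) (v : V) :
    prevProj f k (prevProj f k v) = prevProj f k v := by
  conv_lhs => rw [prevProj]
  conv_rhs => rw [prevProj]
  refine Finset.sum_congr rfl fun l hl => ?_
  rw [inner_prevProj, Finset.sum_eq_single l]
  · rw [mul_comm, mul_smul, inner_gramSchmidtNormed_self_smul]
  · intro l' _ hne
    rw [inner_gramSchmidtNormed_of_ne f hne, zero_mul]
  · exact fun h => absurd hl h

theorem norm_sq_prevProj (f : Fin n → V) (k : ℕ) (v : V) :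
    ‖prevProj f k v‖ ^ 2 = ∑ l ∈ below n k, inner ℝ (gramSchmidtNormed ℝ f l) v ^ 2 := by
  rw [← real_inner_self_eq_norm_sq, inner_prevProj_comm, prevProj_prevProj, ← real_inner_comm,
    inner_prevProj]
  simp only [sq]

theorem norm_sq_sub_prevProj (f : Fin n → V) (k : ℕ) (v : V) :
    ‖v - prevProj f k v‖ ^ 2 = ‖v‖ ^ 2 - ‖prevProj f k v‖ ^ 2 := by
  rw [norm_sub_sq_real, ← real_inner_self_eq_norm_sq (prevProj f k v),
    inner_prevProj_comm f k (prevProj f k v), prevProj_prevProj, inner_prevProj_comm]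
  ring

theorem gramSchmidt_eq_sub_prevProj (f : Fin n → V) (j : Fin n) :
    gramSchmidt ℝ f j = f j - prevProj f j (f j) := by
  rw [gramSchmidt_def, prevProj]
  congr 1
  refine Finset.sum_congr (by ext; rw [mem_below, Finset.mem_Iio]; rfl) fun l _ => ?_
  rw [Submodule.starProjection_singleton, gramSchmidtNormed, inner_smul_left, smul_smul]
  congr 1
  simp
  ring

theorem gramSchmidt_congr {f g : Fin n → V} {k : ℕ} (h : ∀ l : Fin n, (l : ℕ) < k → f l = g l)
    (l : Fin n) (hl : (l : ℕ) < k) : gramSchmidt ℝ f l = gramSchmidt ℝ g l := by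
  induction l using WellFoundedLT.induction with
  | ind l ih =>
    rw [gramSchmidt_def, gramSchmidt_def, h l hl]
    congr 1
    refine Finset.sum_congr rfl fun l' hl' => ?_
    have hlt : l' < l := Finset.mem_Iio.1 hl'
    rw [ih l' hlt (lt_trans hlt hl)]

theorem prevProj_congr {f g : Fin n → V} {k : ℕ} (h : ∀ l : Fin n, (l : ℕ) < k → f l = g l)
    (v : V) : prevProj f k v = prevProj g k v := by
  refine Finset.sum_congr rfl fun l hl => ?_
  simp only [gramSchmidtNormed, gramSchmidt_congr h l (mem_below.1 hl)]

/-- The squared length of a Gram-Schmidt projection is dominated by a sum of squares of coordinates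
in an orthonormal basis: the basis extends the nonzero vectors of the orthonormalized family. -/
theorem norm_sq_prevProj_le (f : Fin n → EuclideanSpace ℝ (Fin n)) (k : ℕ)
    (v : EuclideanSpace ℝ (Fin n)) :
    ‖prevProj f k v‖ ^ 2 ≤ ∑ l ∈ below n k,
      inner ℝ (gramSchmidtOrthonormalBasis (𝕜 := ℝ) (by simp) f l) v ^ 2 := by
  rw [norm_sq_prevProj]
  refine Finset.sum_le_sum fun l _ => ?_
  by_cases h : gramSchmidtNormed ℝ f l = 0
  · rw [h]; simp [sq_nonneg]
  · rw [gramSchmidtOrthonormalBasis_apply (f := f) _ h]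

theorem measurable_column (j : Fin n) : Measurable fun ω : Sample n => column ω j := by
  unfold column Y
  simp only [Matrix.of_apply]
  fun_prop

theorem measurable_gramSchmidt (j : Fin n) :
    Measurable fun ω : Sample n => gramSchmidt ℝ (column ω) j := by
  induction j using WellFoundedLT.induction with
  | ind j ih =>
    have hdef : ∀ ω : Sample n, gramSchmidt ℝ (column ω) j = column ω j -
        ∑ l ∈ Finset.Iio j, (inner ℝ (gramSchmidt ℝ (column ω) l) (column ω j) /
          ‖gramSchmidt ℝ (column ω) l‖ ^ 2) • gramSchmidt ℝ (column ω) l := fun ω => by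
      rw [gramSchmidt_def]
      simp only [Submodule.starProjection_singleton, RCLike.ofReal_real_eq_id, id]
    simp_rw [hdef]
    refine (measurable_column j).sub (Finset.measurable_sum _ fun l hl => ?_)
    have h1 := ih l (Finset.mem_Iio.1 hl)
    have h2 := measurable_column j
    exact ((h1.inner (𝕜 := ℝ) h2).div (h1.norm.pow_const 2)).smul h1

theorem measurable_prevProj (k : ℕ) {v : Sample n → EuclideanSpace ℝ (Fin n)} (hv : Measurable v) :
    Measurable fun ω : Sample n => prevProj (column ω) k (v ω) := by
  unfold prevProj gramSchmidtNormed
  refine Finset.measurable_sum _ fun l _ => ?_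
  have h1 := measurable_gramSchmidt l
  have h2 : Measurable fun ω : Sample n =>
      ((‖gramSchmidt ℝ (column ω) l‖ : ℝ)⁻¹) • gramSchmidt ℝ (column ω) l :=
    h1.norm.inv.smul h1
  exact (h2.inner (𝕜 := ℝ) hv).smul h2

theorem column_update_of_ne (ω : Sample n) {l j : Fin n} (h : l ≠ j) (y : Fin n → ℝ) :
    column (Function.update ω j y) l = column ω l := by
  simp [column, Y, Function.update_of_ne h]

theorem column_update_self (ω : Sample n) (j : Fin n) (y : Fin n → ℝ) :
    column (Function.update ω j y) j = WithLp.toLp 2 y := by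
  simp [column, Y]

theorem prevProj_column_update (ω : Sample n) {k : ℕ} {j : Fin n} (h : k ≤ j) (y : Fin n → ℝ)
    (v : EuclideanSpace ℝ (Fin n)) :
    prevProj (column (Function.update ω j y)) k v = prevProj (column ω) k v :=
  prevProj_congr (fun l hl => column_update_of_ne ω (by rintro rfl; omega) y) v

end GramSchmidt

/-! ### Tail bounds for projections of the columns -/

section Tails

variable {n : ℕ}

theorem measure_norm_column_sq_sub_le (j : Fin n) {t : ℝ} (ht : 0 ≤ t) (htn : t ≤ 2 * n) :
    gaussianMeasure n {ω | t ≤ |‖column ω j‖ ^ 2 - n|} ≤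
      ENNReal.ofReal (2 * Real.exp (-(t ^ 2 / (16 * n)))) := by
  have h1 := measure_le_abs_sum_below_le (γ := gaussianReal 0 1) (n := n)
    (D := fun i y => y i ^ 2 - 1) (fun i => by fun_prop)
    (fun l j hl ω y => by simp [Function.update_of_ne hl.ne]) one_pos
    (fun x hx j ω => by
      simpa using lintegral_exp_sq_gaussianReal (x := x) (by simpa using hx)) le_rfl le_rfl
      j.pos ht (by simpa using htn)
  have hmp := measurePreserving_eval (fun _ : Fin n => gaussianVector n) j
  have hs : MeasurableSet {y : Fin n → ℝ | t ≤ |∑ i ∈ below n n, (y i ^ 2 - 1)|} := by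
    measurability
  have h2 := hmp.measure_preimage hs.nullMeasurableSet
  rw [show (Measure.pi fun _ : Fin n => gaussianVector n) = gaussianMeasure n from rfl] at h2
  simp only [one_pow, mul_one] at h1
  rw [← h2] at h1
  refine le_trans (le_of_eq ?_) h1
  congr 1
  ext ω
  simp [EuclideanSpace.real_norm_sq_eq, below_eq_univ, column, Y]

/-- By rotation invariance of the Gaussian measure, the coordinates in an orthonormal basis are
independent standard Gaussian variables. The exponential moment is taken at `1 / 4`. -/
theorem gaussianVector_sum_inner_sq_le (b : OrthonormalBasis (Fin n) ℝ (EuclideanSpace ℝ (Fin n)))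
    {k : ℕ} (hk : k ≤ n) (t : ℝ) :
    gaussianVector n {y | t ≤ ∑ l ∈ below n k, inner ℝ (b l) (WithLp.toLp 2 y) ^ 2} ≤
      ENNReal.ofReal (Real.exp (k / 2 - t / 4)) := by
  set B : Set (EuclideanSpace ℝ (Fin n)) := {v | t ≤ ∑ l ∈ below n k, inner ℝ (b l) v ^ 2}
  have hB : MeasurableSet B := measurableSet_le measurable_const (by fun_prop)
  have h1 : gaussianVector n {y | t ≤ ∑ l ∈ below n k, inner ℝ (b l) (WithLp.toLp 2 y) ^ 2} =
      stdGaussian (EuclideanSpace ℝ (Fin n)) B := by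
    rw [← map_pi_eq_stdGaussian, Measure.map_apply (by fun_prop) hB]; rfl
  rw [h1, stdGaussian_eq_map_pi_orthonormalBasis b, Measure.map_apply (by fun_prop) hB]
  have h2 := measure_le_sum_below_le (γ := gaussianReal 0 1) (n := n) (x := 1 / 4)
    (D := fun i y => y i ^ 2 - 1) (fun i => by fun_prop)
    (fun l j hl ω y => by simp [Function.update_of_ne hl.ne])
    (fun j ω => by
      simpa using lintegral_exp_sq_gaussianReal (x := 1 / 4) (by norm_num [abs_of_pos])) hk
    (1 / 4 * (t - k))
  refine le_trans (measure_mono fun y hy => ?_) (h2.trans (le_of_eq ?_))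
  · have hin : ∀ l, inner ℝ (b l) (∑ i, y i • b i) = y l := fun l => by
      rw [← b.repr_apply_apply]; simp [b.repr_self, Pi.single_apply]
    have hy' : t ≤ ∑ l ∈ below n k, inner ℝ (b l) (∑ i, y i • b i) ^ 2 := hy
    simp only [hin] at hy'
    simp only [Set.mem_ofPred_eq, Finset.sum_sub_distrib, Finset.sum_const, card_below hk,
      nsmul_eq_mul, mul_one]
    linarith
  · congr 2; ring

theorem measure_norm_prevProj_column_sq_le (j : Fin n) (t : ℝ) :
    gaussianMeasure n {ω | t ≤ ‖prevProj (column ω) j (column ω j)‖ ^ 2} ≤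
      ENNReal.ofReal (Real.exp (j / 2 - t / 4)) := by
  refine measure_pi_le_of_update (γ := gaussianVector n) ?_ j fun ω => ?_
  · exact measurableSet_le measurable_const
      ((measurable_prevProj j (measurable_column j)).norm.pow_const 2)
  · refine le_trans (measure_mono fun y hy => ?_) (gaussianVector_sum_inner_sq_le
      (InnerProductSpace.gramSchmidtOrthonormalBasis (𝕜 := ℝ) (by simp) (column ω)) j.2.le t)
    have hy' : t ≤ _ := hy
    rw [column_update_self, prevProj_column_update ω le_rfl] at hy'
    exact hy'.trans (norm_sq_prevProj_le _ _ _)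

/-- If `u j` depends only on the columns before the `j`-th one, then, given these, the inner product
of the `j`-th column with `u j` is a centered Gaussian variable with variance `‖u j‖ ^ 2`; hence the
centered squares obey a Bernstein inequality. -/
theorem measure_abs_sum_inner_column_sq_le {u : Fin n → Sample n → EuclideanSpace ℝ (Fin n)}
    (hu : ∀ j, Measurable (u j)) (hA : ∀ l j, l ≤ j → ∀ ω y, u l (Function.update ω j y) = u l ω)
    {s : ℝ} (hs : 0 < s) (hus : ∀ j ω, ‖u j ω‖ ^ 2 ≤ s) {k K : ℕ} (hk : k ≤ n) (hkK : k ≤ K)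
    (hK : 0 < K) {τ : ℝ} (hτ : 0 ≤ τ) (hτ2 : τ ≤ 2) :
    gaussianMeasure n
      {ω | τ * K * s ≤ |∑ j ∈ below n k, (inner ℝ (column ω j) (u j ω) ^ 2 - ‖u j ω‖ ^ 2)|} ≤
        ENNReal.ofReal (2 * Real.exp (-(τ ^ 2 * K / 16))) := by
  have hK' : (0 : ℝ) < K := by exact_mod_cast hK
  have := measure_le_abs_sum_below_le (γ := gaussianVector n) (n := n)
    (D := fun j ω => inner ℝ (column ω j) (u j ω) ^ 2 - ‖u j ω‖ ^ 2)
    (fun j => by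
      have h1 := hu j
      have h2 := measurable_column j
      exact ((h2.inner h1).pow_const 2).sub (h1.norm.pow_const 2))
    (fun l j hl ω y => by simp only [hA l j hl.le, column_update_of_ne ω hl.ne]) hs
    (fun x hx j ω => by
      simp only [hA j j le_rfl, column_update_self]
      exact lintegral_exp_inner_sq (u j ω) (hus j ω) hx) hk hkK hK (t := τ * K * s)
      (by positivity) (by gcongr)
  refine this.trans (le_of_eq ?_)
  congr 4
  field_simp

end Tails

/-! ### Norm of a row on the good event -/

section RowEstimate

variable {n : ℕ}

theorem sum_below_val {k : ℕ} (hk : k ≤ n) :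
    ∑ l ∈ below n k, ((l : ℕ) : ℝ) = k * (k - 1) / 2 := by
  induction k with
  | zero => simp
  | succ k ih =>
    rw [below_succ (by omega), Finset.sum_insert (notMem_below_self _), ih (by omega)]
    push_cast; ring

theorem abs_sqrt_sum_sq_sub_le {ι : Type*} (s : Finset ι) (a c : ι → ℝ) :
    |√(∑ j ∈ s, (a j + c j) ^ 2) - √(∑ j ∈ s, a j ^ 2)| ≤ √(∑ j ∈ s, c j ^ 2) := by
  have h : ∀ f : ι → ℝ, √(∑ j ∈ s, f j ^ 2) =
      ‖(WithLp.toLp 2 fun j : s => f j : EuclideanSpace ℝ s)‖ := fun f => by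
    rw [EuclideanSpace.norm_eq]
    simp [Finset.sum_attach s fun j => f j ^ 2]
  rw [h, h, h]
  refine (abs_norm_sub_norm_le _ _).trans (le_of_eq ?_)
  congr 1
  ext j
  simp

theorem abs_sqrt_sub_le {S T ε : ℝ} (hS : 0 ≤ S) (hT : 0 < T)
    (h : |S - T ^ 2| ≤ ε * T ^ 2) : |√S - T| ≤ ε * T := by
  have h1 : |√S - T| * (√S + T) = |S - T ^ 2| := by
    rw [← abs_of_nonneg (show 0 ≤ √S + T by positivity), ← abs_mul]
    congr 1
    nlinarith [Real.sq_sqrt hS]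
  have h2 : |√S - T| * T ≤ ε * T * T := by
    calc _ ≤ |√S - T| * (√S + T) := by
          gcongr
          linarith [Real.sqrt_nonneg S]
      _ ≤ _ := by rw [h1]; linarith
  exact le_of_mul_le_mul_right h2 hT

variable {m : ℕ} {τ : ℝ} {a b w : Fin n → ℝ} {p : ℕ → ℝ}

/-- The estimates on the Gram-Schmidt process, seen from one row of the matrix, which hold with high
probability: `w j` is the squared distance of the `j`-th column to the span of the previous ones,
`b j` is the coordinate in the given row of the corresponding difference vector, and `a j` is the
coordinate of the projection. The squared length of the projection of the basis vector of the row to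
the span of the first `k` columns is `p k`.

The sum over `a` is truncated so that the terms have bounded conditional variance; the truncation
turns out to be void, by `RowEstimates.p_le_two`. -/
structure RowEstimates (n m : ℕ) (τ : ℝ) (a b w : Fin n → ℝ) (p : ℕ → ℝ) : Prop where
  p_eq : ∀ k, p k = ∑ l ∈ below n k, b l ^ 2 / w l
  abs_w_sub_le : ∀ j ∈ below n m, |w j - n| ≤ 2 * τ * √(n * m)
  abs_sum_b_le : ∀ k ≤ m, |∑ l ∈ below n k, (b l ^ 2 - (1 - p l))| ≤ τ * m
  abs_sum_a_le :
    |∑ l ∈ below n m, if p l ≤ 2 * m / n then a l ^ 2 - p l else 0| ≤ τ * m * (2 * m / n)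

namespace RowEstimates

theorem sqrt_mul_le (hmn : m ≤ n) : √((n : ℝ) * m) ≤ n := by
  rw [Real.sqrt_le_left (by positivity), sq]
  have : (m : ℝ) ≤ n := by exact_mod_cast hmn
  gcongr

theorem sum_b_eq {k : ℕ} (hk : k ≤ n) : ∑ l ∈ below n k, b l ^ 2 =
    k - ∑ l ∈ below n k, p l + ∑ l ∈ below n k, (b l ^ 2 - (1 - p l)) := by
  simp [Finset.sum_sub_distrib, card_below hk]

variable (h : RowEstimates n m τ a b w p) (hτ : 0 < τ) (hmn : m ≤ n)
include h hτ hmn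

theorem w_bounds {j : Fin n} (hj : j ∈ below n m) :
    (1 - 2 * τ) * n ≤ w j ∧ w j ≤ (1 + 2 * τ) * n := by
  have h1 := abs_le.1 (h.abs_w_sub_le j hj)
  have h2 : 2 * τ * √((n : ℝ) * m) ≤ 2 * τ * n := by gcongr; exact sqrt_mul_le hmn
  constructor <;> linarith

variable (hτ1 : τ ≤ 1 / 10)
include hτ1

theorem w_pos {j : Fin n} (hj : j ∈ below n m) : 0 < w j := by
  have hn : (0 : ℝ) < n := by exact_mod_cast j.pos
  refine lt_of_lt_of_le ?_ (h.w_bounds hτ hmn hj).1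
  apply mul_pos _ hn; linarith

theorem p_nonneg {k : ℕ} (hk : k ≤ m) : 0 ≤ p k := by
  rw [h.p_eq]
  refine Finset.sum_nonneg fun l hl => div_nonneg (sq_nonneg _) (h.w_pos hτ hmn hτ1 ?_).le
  rw [mem_below] at hl ⊢; omega

theorem sum_b_le {k : ℕ} (hk : k ≤ m) : ∑ l ∈ below n k, b l ^ 2 ≤ k + τ * m := by
  have h1 := (abs_le.1 (h.abs_sum_b_le k hk)).2
  have h2 : 0 ≤ ∑ l ∈ below n k, p l :=
    Finset.sum_nonneg fun l hl => h.p_nonneg hτ hmn hτ1 (by rw [mem_below] at hl; omega)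
  rw [sum_b_eq (p := p) (hk.trans hmn)]
  linarith

theorem p_le (hn : 0 < n) {k : ℕ} (hk : k ≤ m) : p k ≤ k / n + 6 * τ * (m / n) := by
  have hn' : (0 : ℝ) < n := by exact_mod_cast hn
  have hk' : (k : ℝ) ≤ m := by exact_mod_cast hk
  have hpos : 0 < (1 - 2 * τ) * n := mul_pos (by linarith) hn'
  calc p k ≤ ∑ l ∈ below n k, b l ^ 2 / ((1 - 2 * τ) * n) := by
        rw [h.p_eq]
        refine Finset.sum_le_sum fun l hl => ?_
        gcongr
        refine (h.w_bounds hτ hmn ?_).1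
        rw [mem_below] at hl ⊢; omega
    _ = (∑ l ∈ below n k, b l ^ 2) / ((1 - 2 * τ) * n) := by rw [Finset.sum_div]
    _ ≤ (k + τ * m) / ((1 - 2 * τ) * n) := by
        gcongr; exact h.sum_b_le hτ hmn hτ1 hk
    _ ≤ _ := by
        have h0 : (0 : ℝ) ≤ m := by positivity
        rw [div_le_iff₀ hpos]
        have : ((k : ℝ) / n + 6 * τ * (m / n)) * ((1 - 2 * τ) * n) =
            (k + 6 * τ * m) * (1 - 2 * τ) := by field_simp
        rw [this]
        nlinarith [mul_nonneg hτ.le h0, mul_le_mul_of_nonneg_left hk' hτ.le,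
          mul_le_mul_of_nonneg_left hτ1 (mul_nonneg hτ.le h0)]

theorem p_le_two (hn : 0 < n) {k : ℕ} (hk : k ≤ m) : p k ≤ 2 * m / n := by
  have hk' : (k : ℝ) ≤ m := by exact_mod_cast hk
  refine (h.p_le hτ hmn hτ1 hn hk).trans ?_
  rw [← mul_div_assoc, ← add_div]
  gcongr
  nlinarith [(Nat.cast_nonneg m : (0 : ℝ) ≤ m)]

theorem le_p (hn : 0 < n) (hm : (m : ℝ) ≤ τ * n) {k : ℕ} (hk : k ≤ m) :
    k / n - 6 * τ * (m / n) ≤ p k := by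
  have hn' : (0 : ℝ) < n := by exact_mod_cast hn
  have hk' : (k : ℝ) ≤ m := by exact_mod_cast hk
  have h0 : (0 : ℝ) ≤ m := by positivity
  have hsp : ∑ l ∈ below n k, p l ≤ 2 * τ * m := by
    calc _ ≤ ∑ l ∈ below n k, 2 * m / (n : ℝ) := Finset.sum_le_sum fun l hl =>
          h.p_le_two hτ hmn hτ1 hn (by rw [mem_below] at hl; omega)
      _ = k * (2 * m / (n : ℝ)) := by simp [card_below (hk.trans hmn)]
      _ ≤ (τ * n) * (2 * m / (n : ℝ)) := by gcongr; linarith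
      _ = _ := by field_simp
  have hb : k - 3 * τ * m ≤ ∑ l ∈ below n k, b l ^ 2 := by
    have h1 := (abs_le.1 (h.abs_sum_b_le k hk)).1
    rw [sum_b_eq (p := p) (hk.trans hmn)]
    linarith
  calc _ ≤ (k - 3 * τ * m) / ((1 + 2 * τ) * n) := by
        rw [le_div_iff₀ (by positivity)]
        have : ((k : ℝ) / n - 6 * τ * (m / n)) * ((1 + 2 * τ) * n) =
            (k - 6 * τ * m) * (1 + 2 * τ) := by field_simp
        rw [this]
        nlinarith [mul_nonneg hτ.le h0, mul_le_mul_of_nonneg_left hk' hτ.le,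
          mul_nonneg hτ.le (mul_nonneg hτ.le h0)]
    _ ≤ (∑ l ∈ below n k, b l ^ 2) / ((1 + 2 * τ) * n) := by gcongr
    _ = ∑ l ∈ below n k, b l ^ 2 / ((1 + 2 * τ) * n) := by rw [Finset.sum_div]
    _ ≤ p k := by
        rw [h.p_eq]
        refine Finset.sum_le_sum fun l hl => ?_
        have hl' : l ∈ below n m := by rw [mem_below] at hl ⊢; omega
        have := h.w_pos hτ hmn hτ1 hl'
        gcongr
        exact (h.w_bounds hτ hmn hl').2

/-- The main term: `p l` is close to `l / n`, so the sum of the `a l ^ 2` is close to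
`∑ l < m, l / n`. The hypothesis `1 ≤ τ * m` absorbs the difference between that sum and
`m ^ 2 / (2 * n)`. -/
theorem abs_sum_a_sub_le (hn : 0 < n) (hm : (m : ℝ) ≤ τ * n) (hm1 : 1 ≤ τ * m) :
    |∑ l ∈ below n m, a l ^ 2 - m ^ 2 / (2 * n)| ≤ 18 * τ * (m ^ 2 / (2 * n)) := by
  have hn' : (0 : ℝ) < n := by exact_mod_cast hn
  have h0 : (0 : ℝ) ≤ m := by positivity
  have h1 : |∑ l ∈ below n m, (a l ^ 2 - p l)| ≤ τ * m * (2 * m / n) := by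
    refine le_trans (le_of_eq ?_) h.abs_sum_a_le
    congr 1
    refine Finset.sum_congr rfl fun l hl => ?_
    rw [if_pos (h.p_le_two hτ hmn hτ1 hn (mem_below.1 hl).le)]
  have h2 : |∑ l ∈ below n m, (p l - (l : ℕ) / n)| ≤ m * (6 * τ * (m / n)) := by
    calc _ ≤ ∑ l ∈ below n m, |p l - (l : ℕ) / n| := Finset.abs_sum_le_sum_abs _ _
      _ ≤ ∑ l ∈ below n m, 6 * τ * ((m : ℝ) / n) := by
          refine Finset.sum_le_sum fun l hl => abs_le.2 ⟨?_, ?_⟩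
          · linarith [h.le_p hτ hmn hτ1 hn hm (mem_below.1 hl).le]
          · linarith [h.p_le hτ hmn hτ1 hn (mem_below.1 hl).le]
      _ = _ := by simp [card_below hmn]
  have h3 : ∑ l ∈ below n m, ((l : ℕ) : ℝ) / n = m ^ 2 / (2 * n) - m / (2 * n) := by
    rw [← Finset.sum_div, sum_below_val hmn]; field_simp
  have h4 : (m : ℝ) / (2 * n) ≤ τ * m * (m / (2 * n)) := by
    rw [← mul_div_assoc]
    gcongr
    nlinarith
  have h5 : 0 ≤ (m : ℝ) / (2 * n) := by positivity
  rw [Finset.sum_sub_distrib] at h1 h2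
  rw [h3] at h2
  have h6 : τ * m * (2 * m / n) + m * (6 * τ * (m / n)) + τ * m * (m / (2 * n)) ≤
      18 * τ * (m ^ 2 / (2 * n)) := by
    have : 18 * τ * ((m : ℝ) ^ 2 / (2 * n)) - (τ * m * (2 * m / n) + m * (6 * τ * (m / n)) +
        τ * m * (m / (2 * n))) = τ * m ^ 2 / (2 * n) := by field_simp; ring
    have : 0 ≤ τ * (m : ℝ) ^ 2 / (2 * n) := by positivity
    linarith
  rw [abs_le] at *
  constructor <;> linarith [h1.1, h1.2, h2.1, h2.2]

/-- The normalization is negligible: `√n / √(w l)` differs from one by `O(τ * √(m / n))`, and the sum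
of the `b l ^ 2` is `O(m)`. -/
theorem sum_remainder_le (hn : 0 < n) : ∑ l ∈ below n m, (b l * (1 - √n / √(w l))) ^ 2 ≤
    (6 * τ * (m / √n)) ^ 2 := by
  have hn' : (0 : ℝ) < n := by exact_mod_cast hn
  have h0 : (0 : ℝ) ≤ m := by positivity
  have h1 : ∀ l ∈ below n m, (1 - √n / √(w l)) ^ 2 ≤ 16 * τ ^ 2 * (m / n) := by
    intro l hl
    have hw := h.w_pos hτ hmn hτ1 hl
    have hw2 : (n : ℝ) / 4 ≤ w l := by
      refine le_trans ?_ (h.w_bounds hτ hmn hl).1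
      nlinarith
    have e1 : 1 - √n / √(w l) = (w l - n) / (√(w l) * (√(w l) + √n)) := by
      have : 0 < √(w l) := Real.sqrt_pos.2 hw
      field_simp
      have e2 := Real.sq_sqrt hw.le
      have e3 := Real.sq_sqrt hn'.le
      nlinarith
    rw [e1, div_pow, div_le_iff₀ (by positivity)]
    have h2 : (w l - n) ^ 2 ≤ 4 * τ ^ 2 * (n * m) := by
      rw [← sq_abs]
      calc _ ≤ (2 * τ * √(n * m)) ^ 2 := by gcongr; exact h.abs_w_sub_le l hl
        _ = _ := by rw [mul_pow, Real.sq_sqrt (by positivity)]; ring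
    have h3 : (n : ℝ) / 4 * n ≤ (√(w l) * (√(w l) + √n)) ^ 2 := by
      rw [mul_pow, Real.sq_sqrt hw.le]
      gcongr
      calc (n : ℝ) = √n ^ 2 := (Real.sq_sqrt hn'.le).symm
        _ ≤ _ := by gcongr; linarith [Real.sqrt_nonneg (w l)]
    calc _ ≤ _ := h2
      _ = 16 * τ ^ 2 * (m / n) * (n / 4 * n) := by field_simp; ring
      _ ≤ _ := by gcongr
  calc _ ≤ ∑ l ∈ below n m, b l ^ 2 * (16 * τ ^ 2 * (m / n)) := by
        refine Finset.sum_le_sum fun l hl => ?_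
        rw [mul_pow]
        gcongr
        exact h1 l hl
    _ = (∑ l ∈ below n m, b l ^ 2) * (16 * τ ^ 2 * (m / n)) := by rw [Finset.sum_mul]
    _ ≤ (m + τ * m) * (16 * τ ^ 2 * (m / n)) := by
        gcongr; exact h.sum_b_le hτ hmn hτ1 le_rfl
    _ ≤ (2 * m) * (16 * τ ^ 2 * (m / n)) := by
        gcongr; nlinarith
    _ ≤ _ := by
        rw [mul_pow, div_pow, Real.sq_sqrt hn'.le]
        have : (6 * τ) ^ 2 * ((m : ℝ) ^ 2 / n) - 2 * m * (16 * τ ^ 2 * (m / n)) =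
          4 * τ ^ 2 * m ^ 2 / n := by field_simp; ring
        have : 0 ≤ 4 * τ ^ 2 * (m : ℝ) ^ 2 / n := by positivity
        linarith

/-- The row norm on the good event: `a l + b l * (1 - √n / √(w l))` is the entry of `Y - √n U` in
column `l`. -/
theorem abs_norm_sub_le (hn : 0 < n) (hm : (m : ℝ) ≤ τ * n) (hm1 : 1 ≤ τ * m) :
    |√(∑ l ∈ below n m, (a l + b l * (1 - √n / √(w l))) ^ 2) - m / √(2 * n)| ≤
      20 * τ * (m / √n) := by
  have hn' : (0 : ℝ) < n := by exact_mod_cast hn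
  have hm' : (0 : ℝ) < m := by
    by_contra hc
    nlinarith
  have h1 := abs_sqrt_sum_sq_sub_le (below n m) a fun l => b l * (1 - √n / √(w l))
  have h2 : √(∑ l ∈ below n m, (b l * (1 - √n / √(w l))) ^ 2) ≤ 6 * τ * (m / √n) := by
    rw [Real.sqrt_le_left (by positivity)]
    exact h.sum_remainder_le hτ hmn hτ1 hn
  have hT : (m / √(2 * n) : ℝ) ^ 2 = m ^ 2 / (2 * n) := by
    rw [div_pow, Real.sq_sqrt (by positivity)]
  have h3 : |√(∑ l ∈ below n m, a l ^ 2) - m / √(2 * n)| ≤ 18 * τ * (m / √(2 * n)) := by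
    refine abs_sqrt_sub_le (Finset.sum_nonneg fun _ _ => sq_nonneg _) (by positivity) ?_
    rw [hT]
    exact h.abs_sum_a_sub_le hτ hmn hτ1 hn hm hm1
  have h4 : (m : ℝ) / √(2 * n) ≤ 3 / 4 * (m / √n) := by
    rw [Real.sqrt_mul (by norm_num)]
    have h5 : (4 / 3 : ℝ) ≤ √2 := Real.le_sqrt_of_sq_le (by norm_num)
    rw [← div_div, div_le_iff₀ (by positivity) (c := √(n : ℝ))]
    have : 3 / 4 * (m / √(n : ℝ)) * √n = 3 / 4 * m := by field_simp
    rw [this, div_le_iff₀ (by positivity)]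
    nlinarith
  have h5 : 0 ≤ τ * (m / √n) := by positivity
  have h6 := mul_le_mul_of_nonneg_left h4 hτ.le
  have h7 := abs_sub_le (√(∑ l ∈ below n m, (a l + b l * (1 - √n / √(w l))) ^ 2))
    (√(∑ l ∈ below n m, a l ^ 2)) (m / √(2 * n))
  linarith

end RowEstimates

end RowEstimate

/-! ### Probability of the row estimates -/

section RowProbability

open InnerProductSpace

variable {n : ℕ}

/-- The coordinate in row `i` of the projection of the `j`-th column to the span of the previous
ones. -/
noncomputable def projCoord (ω : Sample n) (i j : Fin n) : ℝ :=
  inner ℝ (column ω j) (prevProj (column ω) j (EuclideanSpace.single i 1))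

/-- The coordinate in row `i` of the `j`-th vector of the Gram-Schmidt process, before
normalization. -/
noncomputable def residCoord (ω : Sample n) (i j : Fin n) : ℝ :=
  inner ℝ (column ω j)
    (EuclideanSpace.single i 1 - prevProj (column ω) j (EuclideanSpace.single i 1))

/-- The squared length of the projection of the `i`-th basis vector to the span of the first `k`
columns. -/
noncomputable def rowMass (ω : Sample n) (i : Fin n) (k : ℕ) : ℝ :=
  ‖prevProj (column ω) k (EuclideanSpace.single i 1)‖ ^ 2

theorem gramSchmidt_column_apply (ω : Sample n) (i j : Fin n) :
    gramSchmidt ℝ (column ω) j i = residCoord ω i j := by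
  have h : ∀ v : EuclideanSpace ℝ (Fin n), v i = inner ℝ v (EuclideanSpace.single i 1) := by
    simp [EuclideanSpace.inner_single_right]
  rw [h, gramSchmidt_eq_sub_prevProj, residCoord, inner_sub_left, inner_sub_right,
    inner_prevProj_comm]

theorem Y_eq_add (ω : Sample n) (i j : Fin n) : Y ω i j = projCoord ω i j + residCoord ω i j := by
  rw [projCoord, residCoord, ← inner_add_right, add_sub_cancel]
  simp [column, EuclideanSpace.inner_single_right]

/-- If the Gram-Schmidt vector vanishes, both sides are zero. -/
theorem U_apply (ω : Sample n) (i j : Fin n) :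
    U ω i j = residCoord ω i j / √(‖gramSchmidt ℝ (column ω) j‖ ^ 2) := by
  rw [Real.sqrt_sq (norm_nonneg _), ← gramSchmidt_column_apply]
  simp [U, gramSchmidtNormed, div_eq_inv_mul]

theorem norm_F_eq (m : ℕ) (ω : Sample n) (i : Fin n) :
    ‖F m ω i‖ = √(∑ j ∈ below n m, (projCoord ω i j + residCoord ω i j *
      (1 - √n / √(‖gramSchmidt ℝ (column ω) j‖ ^ 2))) ^ 2) := by
  rw [EuclideanSpace.norm_eq]
  congr 1
  have : ∀ j : Fin n, projCoord ω i j + residCoord ω i j *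
      (1 - √n / √(‖gramSchmidt ℝ (column ω) j‖ ^ 2)) = (Y ω - √(n : ℝ) • U ω) i j := by
    intro j
    rw [Matrix.sub_apply, Matrix.smul_apply, Y_eq_add, U_apply, smul_eq_mul]
    ring
  simp_rw [this, F, Real.norm_eq_abs, sq_abs]
  exact (Finset.sum_subtype (below n m) (fun j => mem_below)
    (fun j => ((Y ω - √(n : ℝ) • U ω) i j) ^ 2)).symm

theorem rowMass_eq (ω : Sample n) (i : Fin n) (k : ℕ) : rowMass ω i k =
    ∑ l ∈ below n k, residCoord ω i l ^ 2 / ‖gramSchmidt ℝ (column ω) l‖ ^ 2 := by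
  rw [rowMass, norm_sq_prevProj]
  refine Finset.sum_congr rfl fun l _ => ?_
  rw [gramSchmidtNormed, inner_smul_left, ← gramSchmidt_column_apply, ← div_pow]
  simp [div_eq_inv_mul, EuclideanSpace.inner_single_right]

/-- Given the previous columns, `residCoord ω i l` is a centered Gaussian variable with variance
`1 - rowMass ω i l`. -/
theorem measure_residCoord_le (i : Fin n) {k m : ℕ} (hm : 0 < m) (hmn : m ≤ n) (hk : k ≤ m) {τ : ℝ}
    (hτ : 0 ≤ τ) (hτ2 : τ ≤ 2) :
    gaussianMeasure n
      {ω | τ * m ≤ |∑ l ∈ below n k, (residCoord ω i l ^ 2 - (1 - rowMass ω i l))|} ≤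
        ENNReal.ofReal (2 * Real.exp (-(τ ^ 2 * m / 16))) := by
  have hnorm : ∀ (ω : Sample n) (j : Fin n), ‖EuclideanSpace.single i (1 : ℝ) -
      prevProj (column ω) j (EuclideanSpace.single i 1)‖ ^ 2 = 1 - rowMass ω i j := by
    intro ω j
    rw [norm_sq_sub_prevProj]; simp [rowMass]
  have := measure_abs_sum_inner_column_sq_le (n := n)
    (u := fun j ω => EuclideanSpace.single i 1 -
      prevProj (column ω) j (EuclideanSpace.single i 1))
    (fun j => measurable_const.sub (measurable_prevProj j measurable_const))
    (fun l j hl ω y => by simp only [prevProj_column_update ω hl]) one_pos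
    (fun j ω => by
      rw [hnorm]
      have : 0 ≤ rowMass ω i j := sq_nonneg _
      linarith) (hk.trans hmn) hk hm hτ hτ2
  simpa only [hnorm, mul_one, residCoord] using this

/-- Given the previous columns, `projCoord ω i l` is a centered Gaussian variable with variance
`rowMass ω i l`; the truncation keeps all the variances below `s`. -/
theorem measure_projCoord_le (i : Fin n) {m : ℕ} (hm : 0 < m) (hmn : m ≤ n) {τ s : ℝ}
    (hτ : 0 ≤ τ) (hτ2 : τ ≤ 2) (hs : 0 < s) :
    gaussianMeasure n {ω | τ * m * s ≤ |∑ l ∈ below n m,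
      if rowMass ω i l ≤ s then projCoord ω i l ^ 2 - rowMass ω i l else 0|} ≤
        ENNReal.ofReal (2 * Real.exp (-(τ ^ 2 * m / 16))) := by
  have hmeas : ∀ j : Fin n, Measurable fun ω : Sample n =>
      prevProj (column ω) j (EuclideanSpace.single i 1) := fun j =>
    measurable_prevProj j measurable_const
  have := measure_abs_sum_inner_column_sq_le (n := n)
    (u := fun j ω => if rowMass ω i j ≤ s then
      prevProj (column ω) j (EuclideanSpace.single i 1) else 0)
    (fun j => Measurable.ite (measurableSet_le ((hmeas j).norm.pow_const 2) measurable_const)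
      (hmeas j) measurable_const)
    (fun l j hl ω y => by
      have h : rowMass (Function.update ω j y) i l = rowMass ω i l := by
        rw [rowMass, prevProj_column_update ω hl, rowMass]
      rw [h, prevProj_column_update ω hl]) hs
    (fun j ω => by
      split_ifs with h
      · exact h
      · simpa using hs.le) hmn le_rfl hm hτ hτ2
  refine le_trans (le_of_eq ?_) this
  congr 1
  ext ω
  simp only [Set.mem_ofPred_eq]
  refine iff_of_eq ?_
  congr 2
  refine Finset.sum_congr rfl fun l _ => ?_
  split_ifs with h
  · rfl
  · simp

theorem measure_not_rowEstimates_le (i : Fin n) {m : ℕ} (hm : 0 < m) (hmn : m ≤ n) {τ : ℝ}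
    (hτ : 0 < τ) (hτ1 : τ ≤ 1 / 10) (hmτ : (m : ℝ) ≤ τ ^ 2 / 64 * n) :
    gaussianMeasure n {ω | ¬ RowEstimates n m τ (projCoord ω i) (residCoord ω i)
      (fun j => ‖gramSchmidt ℝ (column ω) j‖ ^ 2) (rowMass ω i)} ≤
        ENNReal.ofReal (9 * m * Real.exp (-(τ ^ 2 * m / 16))) := by
  have hn : (0 : ℝ) < n := by exact_mod_cast i.pos
  have hm0 : (0 : ℝ) < m := by exact_mod_cast hm
  have hm1 : (1 : ℝ) ≤ m := by exact_mod_cast hm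
  have hmn' : (m : ℝ) ≤ n := by exact_mod_cast hmn
  set E := Real.exp (-(τ ^ 2 * m / 16)) with hE
  have hEpos : 0 < E := Real.exp_pos _
  set t := τ * √(n * m) with ht
  have ht0 : 0 ≤ t := by positivity
  have ht1 : t ≤ 2 * n := by
    have := RowEstimates.sqrt_mul_le hmn
    calc t ≤ 2 * √(n * m) := by rw [ht]; gcongr; linarith
      _ ≤ _ := by gcongr
  -- `t` dominates the dimension of the projection, which makes its exponential tail effective.
  have ht2 : 8 * m ≤ t := by
    have h1 : 8 * m / τ ≤ √((n : ℝ) * m) := by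
      apply Real.le_sqrt_of_sq_le
      rw [div_pow, div_le_iff₀ (by positivity)]
      nlinarith
    rw [div_le_iff₀ hτ] at h1
    linarith
  have hcol : ∀ j : Fin n, gaussianMeasure n {ω | t ≤ |‖column ω j‖ ^ 2 - n|} ≤
      ENNReal.ofReal (2 * E) := fun j => by
    refine (measure_norm_column_sq_sub_le j ht0 ht1).trans (le_of_eq ?_)
    rw [ht, hE, mul_pow, Real.sq_sqrt (by positivity)]
    congr 4
    field_simp
  have hproj : ∀ j ∈ below n m,
      gaussianMeasure n {ω | t ≤ ‖prevProj (column ω) j (column ω j)‖ ^ 2} ≤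
        ENNReal.ofReal E := fun j hj => by
    refine (measure_norm_prevProj_column_sq_le j t).trans
      (ENNReal.ofReal_le_ofReal (Real.exp_le_exp.2 ?_))
    have hj' : ((j : ℕ) : ℝ) ≤ m := by exact_mod_cast (mem_below.1 hj).le
    have hτ2 : τ ^ 2 * m ≤ 1 * m := by gcongr; nlinarith
    linarith
  have hsub : {ω | ¬ RowEstimates n m τ (projCoord ω i) (residCoord ω i)
      (fun j => ‖gramSchmidt ℝ (column ω) j‖ ^ 2) (rowMass ω i)} ⊆
      (⋃ j ∈ below n m, ({ω | t ≤ |‖column ω j‖ ^ 2 - n|} ∪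
        {ω | t ≤ ‖prevProj (column ω) j (column ω j)‖ ^ 2})) ∪
      ((⋃ k ∈ Finset.range (m + 1),
        {ω | τ * m ≤ |∑ l ∈ below n k, (residCoord ω i l ^ 2 - (1 - rowMass ω i l))|}) ∪
      {ω | τ * m * (2 * m / n) ≤ |∑ l ∈ below n m,
        if rowMass ω i l ≤ 2 * m / n then projCoord ω i l ^ 2 - rowMass ω i l else 0|}) := by
    intro ω hω
    by_contra hcon
    simp only [Set.mem_union, Set.mem_iUnion, Set.mem_ofPred_eq, not_or, not_exists,
      not_le] at hcon
    obtain ⟨h1, h2, h3⟩ := hcon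
    refine hω ⟨rowMass_eq ω i, fun j hj => ?_, fun k hk => ?_, h3.le⟩
    · obtain ⟨h4, h5⟩ := h1 j hj
      rw [gramSchmidt_eq_sub_prevProj, norm_sq_sub_prevProj, mul_assoc, ← ht]
      have h6 := sq_nonneg ‖prevProj (column ω) j (column ω j)‖
      rw [abs_lt] at h4
      rw [abs_le]
      constructor <;> linarith
    · exact (h2 k (by simpa [Nat.lt_succ_iff] using hk)).le
  refine (measure_mono hsub).trans ?_
  refine (measure_union_le _ _).trans ((add_le_add ((measure_biUnion_finset_le _ _).trans
    (Finset.sum_le_sum fun j hj => (measure_union_le _ _).trans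
      (add_le_add (hcol j) (hproj j hj)))) ((measure_union_le _ _).trans (add_le_add
      ((measure_biUnion_finset_le _ _).trans (Finset.sum_le_sum fun k hk =>
        measure_residCoord_le i hm hmn (by simpa [Nat.lt_succ_iff] using hk) hτ.le (by linarith)))
      (measure_projCoord_le i hm hmn hτ.le (by linarith) (by positivity))))).trans ?_)
  simp only [Finset.sum_const, card_below hmn, Finset.card_range, nsmul_eq_mul]
  rw [← hE, ← ENNReal.ofReal_add (by positivity) (by positivity), ← ENNReal.ofReal_natCast,
    ← ENNReal.ofReal_natCast, ← ENNReal.ofReal_mul (by positivity),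
    ← ENNReal.ofReal_mul (by positivity), ← ENNReal.ofReal_add (by positivity) (by positivity),
    ← ENNReal.ofReal_add (by positivity) (by positivity)]
  apply ENNReal.ofReal_le_ofReal
  push_cast
  nlinarith

/-- With high probability all rows satisfy the norm estimate; `measure_not_rowEstimates_le` is used
for each row, with a union bound over the rows. -/
theorem measure_exists_row_le {m : ℕ} (hmn : m ≤ n) {τ : ℝ}
    (hτ : 0 < τ) (hτ1 : τ ≤ 1 / 10) (hmτ : (m : ℝ) ≤ τ ^ 2 / 64 * n) (hm1 : 1 ≤ τ * m) :
    (gaussianMeasure n).real {ω | ∃ i, 20 * τ * (m / √n) < |‖F m ω i‖ - m / √(2 * n)|} ≤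
      n * (9 * m * Real.exp (-(τ ^ 2 * m / 16))) := by
  have hm : 0 < m := by
    rcases Nat.eq_zero_or_pos m with h | h
    · subst h; norm_num at hm1
    · exact h
  apply ENNReal.toReal_le_of_le_ofReal (by positivity)
  calc _ ≤ gaussianMeasure n (⋃ i, {ω | ¬ RowEstimates n m τ (projCoord ω i) (residCoord ω i)
          (fun j => ‖gramSchmidt ℝ (column ω) j‖ ^ 2) (rowMass ω i)}) := by
        refine measure_mono fun ω ⟨i, hi⟩ => Set.mem_iUnion.2 ⟨i, fun h => ?_⟩
        refine absurd hi (not_lt.2 ?_)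
        rw [norm_F_eq]
        refine h.abs_norm_sub_le hτ hmn hτ1 i.pos (hmτ.trans ?_) hm1
        gcongr
        nlinarith
    _ ≤ ∑ i : Fin n, _ := measure_iUnion_fintype_le _ _
    _ ≤ ∑ i : Fin n, ENNReal.ofReal (9 * m * Real.exp (-(τ ^ 2 * m / 16))) :=
        Finset.sum_le_sum fun i _ => measure_not_rowEstimates_le i hm hmn hτ hτ1 hmτ
    _ = _ := by
        rw [ENNReal.ofReal_mul (by positivity)]
        simp

end RowProbability

/-! ### Asymptotics of the row norms -/

section Asymptotic

instance (n : ℕ) : IsProbabilityMeasure (gaussianMeasure n) := by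
  unfold gaussianMeasure; infer_instance

theorem norm_F_le_supF {n : ℕ} (m : ℕ) (ω : Sample n) (i : Fin n) : ‖F m ω i‖ ≤ supF m ω :=
  le_ciSup (f := fun i => ‖F m ω i‖) (Set.finite_range _).bddAbove i

theorem infF_nonneg {n : ℕ} (m : ℕ) (ω : Sample n) : 0 ≤ infF m ω :=
  Real.iInf_nonneg fun _ => norm_nonneg _

theorem norm_F_mono {n m m' : ℕ} (h : m ≤ m') (ω : Sample n) (i : Fin n) :
    ‖F m ω i‖ ≤ ‖F m' ω i‖ := by
  rw [norm_F_eq, norm_F_eq]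
  apply Real.sqrt_le_sqrt
  refine Finset.sum_le_sum_of_subset_of_nonneg (fun j hj => ?_) fun _ _ _ => sq_nonneg _
  rw [mem_below] at *; omega

theorem supF_zero {n : ℕ} (ω : Sample n) : supF 0 ω = 0 := by
  simp [supF, norm_F_eq]

theorem div_sqrt_two_mul_le (m n : ℕ) : (m : ℝ) / √(2 * n) ≤ m / √n := by
  rcases Nat.eq_zero_or_pos n with rfl | hn
  · simp
  · have : (0 : ℝ) < n := by exact_mod_cast hn
    gcongr
    linarith

theorem half_mul_le_div_sqrt_two_mul (m n : ℕ) : 1 / 2 * ((m : ℝ) / √n) ≤ m / √(2 * n) := by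
  have h : √(2 * (n : ℝ)) ≤ 2 * √n := by
    rw [Real.sqrt_le_left (by positivity), mul_pow, Real.sq_sqrt (by positivity)]
    linarith [(Nat.cast_nonneg n : (0 : ℝ) ≤ n)]
  rcases Nat.eq_zero_or_pos n with rfl | hn
  · simp
  · have : (0 : ℝ) < n := by exact_mod_cast hn
    calc 1 / 2 * ((m : ℝ) / √n) = m / (2 * √n) := by field_simp
      _ ≤ _ := by gcongr

theorem tendsto_nat_mul_exp_neg_rpow {a c : ℝ} (ha : 0 < a) (hc : 0 < c) :
    Tendsto (fun n : ℕ => (n : ℝ) * Real.exp (-(c * (n : ℝ) ^ a))) atTop (𝓝 0) := by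
  have h := (tendsto_rpow_mul_exp_neg_mul_atTop_nhds_zero (1 / a) c hc).comp
    ((tendsto_rpow_atTop ha).comp tendsto_natCast_atTop_atTop)
  refine h.congr fun n => ?_
  simp only [Function.comp_apply]
  rw [← Real.rpow_mul (by positivity), mul_one_div_cancel ha.ne', Real.rpow_one, neg_mul]

theorem eventually_mul_exp_lt {c : ℝ} (hc : 0 < c) :
    ∀ᶠ m : ℕ in atTop, 9 * m * Real.exp (-(c * m)) < Real.exp (-√m) := by
  have h1 : Tendsto (fun m : ℕ => (m : ℝ) * Real.exp (-(c / 2 * m))) atTop (𝓝 0) := by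
    simpa using tendsto_nat_mul_exp_neg_rpow one_pos (half_pos hc)
  filter_upwards [h1.eventually_lt_const (show (0 : ℝ) < 1 / 9 by norm_num),
    (tendsto_natCast_atTop_atTop (R := ℝ)).eventually_ge_atTop (4 / c ^ 2)] with m hm1 hm2
  have h2 : √(m : ℝ) ≤ c / 2 * m := by
    rw [Real.sqrt_le_left (by positivity), mul_pow]
    rw [div_le_iff₀ (by positivity)] at hm2
    nlinarith [(Nat.cast_nonneg m : (0 : ℝ) ≤ m)]
  calc 9 * m * Real.exp (-(c * m)) =
        9 * (m * Real.exp (-(c / 2 * m))) * Real.exp (-(c / 2 * m)) := by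
        rw [mul_assoc 9, mul_assoc 9, mul_assoc (m : ℝ), ← Real.exp_add]; ring_nf
    _ < 1 * Real.exp (-(c / 2 * m)) := by gcongr; linarith
    _ ≤ _ := by rw [one_mul]; gcongr

/-- Either the claimed probability bound is void, or every row obeys its norm estimate with high
probability: if `n * exp (-√m) ≤ 1`, then `m ≥ (log n) ^ 2` tends to infinity with `n`. -/
theorem eventually_measure_exists_row_lt {m : ℕ → ℕ} (hmn : ∀ n, m n ≤ n)
    (hm : Tendsto (fun n : ℕ => (m n : ℝ) / (n : ℝ)) atTop (𝓝 0)) {δ : ℝ} (hδ : 0 < δ) :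
    ∀ᶠ n : ℕ in atTop, 1 < n * Real.exp (-√(m n)) ∨
      (gaussianMeasure n).real {ω | ∃ i, δ * (m n / √n) < |‖F (m n) ω i‖ - m n / √(2 * n)|} <
        n * Real.exp (-√(m n)) := by
  -- The row estimate with parameter `τ` has deviation `20 * τ * (m / √n)` and needs `τ ≤ 1 / 10`.
  set τ : ℝ := min (δ / 20) (1 / 10) with hτdef
  have hτ : 0 < τ := by positivity
  obtain ⟨M, hM⟩ := eventually_atTop.1 ((eventually_mul_exp_lt (c := τ ^ 2 / 16) (by positivity)).and
    ((tendsto_natCast_atTop_atTop (R := ℝ)).eventually_ge_atTop (1 / τ)))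
  filter_upwards [hm.eventually_lt_const (show 0 < τ ^ 2 / 64 by positivity),
    eventually_gt_atTop 0, (tendsto_natCast_atTop_atTop (R := ℝ)).eventually_gt_atTop
      (Real.exp √M)] with n hn1 hn0 hnM
  have hn : (0 : ℝ) < n := by exact_mod_cast hn0
  by_cases htriv : 1 < n * Real.exp (-√(m n))
  · exact Or.inl htriv
  right
  have hMm : M ≤ m n := by
    by_contra hlt
    apply htriv
    calc (1 : ℝ) = Real.exp √M * Real.exp (-√M) := by rw [← Real.exp_add]; simp
      _ < n * Real.exp (-√M) := by gcongr
      _ ≤ _ := by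
        have : (m n : ℝ) ≤ M := by exact_mod_cast (not_le.1 hlt).le
        gcongr
  obtain ⟨h1, h2⟩ := hM _ hMm
  rw [div_le_iff₀' hτ] at h2
  rw [div_lt_iff₀ hn] at hn1
  have h3 := measure_exists_row_le (hmn n) hτ (min_le_right _ _) hn1.le h2
  calc _ ≤ (gaussianMeasure n).real
          {ω | ∃ i, 20 * τ * (m n / √n) < |‖F (m n) ω i‖ - m n / √(2 * n)|} := by
        refine measureReal_mono fun ω ⟨i, hi⟩ => ⟨i, lt_of_le_of_lt ?_ hi⟩
        gcongr
        linarith [min_le_left (δ / 20) (1 / 10 : ℝ)]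
    _ ≤ _ := h3
    _ < _ := by
        rw [show τ ^ 2 * (m n : ℝ) / 16 = τ ^ 2 / 16 * m n by ring]
        gcongr

/-- All row norms are at most `m / √(2n) + r`, and all are at least `m / √(2n) - r`, each with
probability greater than `1 - n * exp (-√m)`. -/
def NormBounds (n m : ℕ) (r : ℝ) : Prop :=
  1 - n * Real.exp (-√m) < (gaussianMeasure n).real {ω | supF m ω ≤ m / √(2 * n) + r} ∧
  1 - n * Real.exp (-√m) < (gaussianMeasure n).real {ω | m / √(2 * n) - r ≤ infF m ω}

theorem NormBounds.mono {n m : ℕ} {r r' : ℝ} (h : NormBounds n m r) (hr : r ≤ r') :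
    NormBounds n m r' :=
  ⟨h.1.trans_le (measureReal_mono fun ω (hω : supF m ω ≤ _) => hω.trans (by gcongr)),
    h.2.trans_le (measureReal_mono fun ω (hω : _ ≤ infF m ω) => le_trans (by gcongr) hω)⟩

theorem eventually_normBounds {m : ℕ → ℕ} (hmn : ∀ n, m n ≤ n)
    (hm : Tendsto (fun n : ℕ => (m n : ℝ) / (n : ℝ)) atTop (𝓝 0)) {δ : ℝ} (hδ : 0 < δ) :
    ∀ᶠ n : ℕ in atTop, NormBounds n (m n) (δ * (m n / √n)) := by
  filter_upwards [eventually_measure_exists_row_lt hmn hm hδ, eventually_gt_atTop 0] with n h hn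
  have : Nonempty (Fin n) := ⟨⟨0, hn⟩⟩
  rcases h with h | h
  · exact ⟨lt_of_lt_of_le (by linarith) measureReal_nonneg,
      lt_of_lt_of_le (by linarith) measureReal_nonneg⟩
  · have key : ∀ A : Set (Sample n), (∀ ω, (∀ i, |‖F (m n) ω i‖ - m n / √(2 * n)| ≤
        δ * (m n / √n)) → ω ∈ A) → 1 - n * Real.exp (-√(m n)) < (gaussianMeasure n).real A := by
      intro A hA
      have h1 : (gaussianMeasure n).real Set.univ ≤ (gaussianMeasure n).real A +
          (gaussianMeasure n).real
            {ω | ∃ i, δ * (m n / √n) < |‖F (m n) ω i‖ - m n / √(2 * n)|} := by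
        refine le_trans (measureReal_mono fun ω _ => ?_) (measureReal_union_le _ _)
        by_cases hω : ∀ i, |‖F (m n) ω i‖ - m n / √(2 * n)| ≤ δ * (m n / √n)
        · exact Or.inl (hA ω hω)
        · push Not at hω
          exact Or.inr hω
      rw [probReal_univ] at h1
      linarith
    refine ⟨key _ fun ω hω => ?_, key _ fun ω hω => ?_⟩
    · refine ciSup_le (f := fun i => ‖F (m n) ω i‖) fun i => ?_
      linarith [(abs_le.1 (hω i)).2]
    · refine le_ciInf (f := fun i => ‖F (m n) ω i‖) fun i => ?_
      linarith [(abs_le.1 (hω i)).1]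

/-- At fixed `n` some deviation is admissible: `supF` is finite and `infF` is nonnegative, while the
claimed probability is less than one. -/
theorem exists_normBounds {n : ℕ} (hn : 1 ≤ n) (m : ℕ) :
    ∃ δ : ℝ, 0 ≤ δ ∧ NormBounds n m (δ * (m / √n)) := by
  have hn' : (0 : ℝ) < n := by exact_mod_cast hn
  have hlt : 1 - n * Real.exp (-√m) < 1 := by
    have : 0 < n * Real.exp (-√m) := by positivity
    linarith
  set A : ℕ → Set (Sample n) := fun N => {ω | supF m ω ≤ m / √(2 * n) + N * (m / √n)} with hA
  have hmono : Monotone A := fun N N' hN ω (hω : supF m ω ≤ _) => by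
    change supF m ω ≤ _
    exact hω.trans (by gcongr)
  have hunion : ⋃ N, A N = Set.univ := by
    refine Set.eq_univ_of_forall fun ω => Set.mem_iUnion.2 ?_
    rcases Nat.eq_zero_or_pos m with rfl | hm
    · exact ⟨0, by simp [hA, supF_zero]⟩
    · have hm' : (0 : ℝ) < m := by exact_mod_cast hm
      obtain ⟨N, hN⟩ := exists_nat_ge (supF m ω / (m / √n))
      refine ⟨N, ?_⟩
      rw [div_le_iff₀ (by positivity)] at hN
      have : 0 ≤ (m : ℝ) / √(2 * n) := by positivity
      simp only [hA, Set.mem_ofPred_eq]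
      linarith
  have htend := tendsto_measure_iUnion_atTop (μ := gaussianMeasure n) hmono
  rw [hunion, measure_univ] at htend
  have htend' : Tendsto (fun N => (gaussianMeasure n).real (A N)) atTop (𝓝 1) := by
    exact (ENNReal.tendsto_toReal ENNReal.one_ne_top).comp htend
  obtain ⟨N, hN, hN1⟩ := ((htend'.eventually_const_lt hlt).and (eventually_ge_atTop 1)).exists
  refine ⟨N, by positivity, hN, ?_⟩
  have huniv : {ω : Sample n | m / √(2 * n) - N * (m / √n) ≤ infF m ω} = Set.univ := by
    refine Set.eq_univ_of_forall fun ω => ?_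
    have h1 := div_sqrt_two_mul_le m n
    have h2 : (1 : ℝ) ≤ N := by exact_mod_cast hN1
    have h3 : 0 ≤ (m : ℝ) / √n := by positivity
    have h4 := infF_nonneg m ω
    simp only [Set.mem_ofPred_eq]
    nlinarith
  rw [huniv, probReal_univ]
  exact hlt

/-- The least admissible deviations, measured in units of `m / √n`, tend to zero. -/
theorem exists_isLittleO_normBounds {m : ℕ → ℕ} (hmn : ∀ n, m n ≤ n)
    (hm : Tendsto (fun n : ℕ => (m n : ℝ) / (n : ℝ)) atTop (𝓝 0)) :
    ∃ r : ℕ → ℝ, r =o[atTop] (fun n : ℕ => (m n : ℝ) / √(n : ℝ)) ∧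
      ∀ n, 1 ≤ n → NormBounds n (m n) (r n) := by
  set S : ℕ → Set ℝ := fun n => {δ | 0 ≤ δ ∧ NormBounds n (m n) (δ * (m n / √n))} with hS
  have hbdd : ∀ n, BddBelow (S n) := fun n => ⟨0, fun δ hδ => hδ.1⟩
  have h0 : ∀ n, 0 ≤ sInf (S n) := fun n => Real.sInf_nonneg fun δ hδ => hδ.1
  have hlim : Tendsto (fun n => sInf (S n)) atTop (𝓝 0) := by
    rw [Metric.tendsto_atTop']
    intro ε hε
    obtain ⟨N, hN⟩ := eventually_atTop.1 (eventually_normBounds hmn hm (half_pos hε))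
    refine ⟨N, fun n hn => ?_⟩
    have := csInf_le (hbdd n) ⟨(half_pos hε).le, hN n hn.le⟩
    rw [Real.dist_eq, sub_zero, abs_of_nonneg (h0 n)]
    linarith
  -- The infimum need not be attained, so it is enlarged by a null sequence.
  refine ⟨fun n => (sInf (S n) + 1 / ((n : ℝ) + 1)) * (m n / √n), ?_, fun n hn => ?_⟩
  · rw [isLittleO_iff_exists_eq_mul]
    refine ⟨fun n => sInf (S n) + 1 / ((n : ℝ) + 1), ?_, EventuallyEq.rfl⟩
    simpa using hlim.add (tendsto_one_div_add_atTop_nhds_zero_nat (𝕜 := ℝ))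
  · obtain ⟨δ, hδ, hlt⟩ := Real.lt_sInf_add_pos (exists_normBounds hn (m n) : (S n).Nonempty)
      (show (0 : ℝ) < 1 / ((n : ℝ) + 1) by positivity)
    exact hδ.2.mono (mul_le_mul_of_nonneg_right hlt.le (by positivity))

/-- For bounded or slowly growing `m` the exponential bound says nothing, but `supF` increases with
`m`, so `m` may be replaced by `max m (n ^ (1 / 4))`, which is still `o(√n)`. -/
theorem tendsto_supF_of_isLittleO {m : ℕ → ℕ} (hmn : ∀ n, m n ≤ n)
    (ho : (fun n : ℕ => (m n : ℝ)) =o[atTop] (fun n : ℕ => √(n : ℝ))) {ε : ℝ} (hε : 0 < ε) :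
    Tendsto (fun n : ℕ => (gaussianMeasure n).real {ω | ε < supF (m n) ω}) atTop (𝓝 0) := by
  set q : ℕ → ℕ := fun n => ⌈(n : ℝ) ^ (1 / 4 : ℝ)⌉₊ with hq
  set M : ℕ → ℕ := fun n => max (m n) (q n) with hMdef
  have hqn : ∀ n, q n ≤ n := fun n => by
    rw [hq, Nat.ceil_le]
    rcases Nat.eq_zero_or_pos n with rfl | hn
    · simp [Real.zero_rpow]
    · have : (1 : ℝ) ≤ n := by exact_mod_cast hn
      calc (n : ℝ) ^ (1 / 4 : ℝ) ≤ (n : ℝ) ^ (1 : ℝ) := by gcongr; norm_num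
        _ = n := Real.rpow_one _
  have hMn : ∀ n, M n ≤ n := fun n => max_le (hmn n) (hqn n)
  have hmlim : Tendsto (fun n : ℕ => (m n : ℝ) / √n) atTop (𝓝 0) := ho.tendsto_div_nhds_zero
  have hqlim : Tendsto (fun n : ℕ => (q n : ℝ) / √n) atTop (𝓝 0) := by
    have h1 : Tendsto (fun n : ℕ => (n : ℝ) ^ (-(1 / 4) : ℝ) + (n : ℝ) ^ (-(1 / 2) : ℝ)) atTop
        (𝓝 0) := by
      rw [← add_zero (0 : ℝ)]
      exact ((tendsto_rpow_neg_atTop (show (0 : ℝ) < 1 / 4 by norm_num)).add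
        (tendsto_rpow_neg_atTop (show (0 : ℝ) < 1 / 2 by norm_num))).comp
          tendsto_natCast_atTop_atTop
    refine tendsto_of_tendsto_of_tendsto_of_le_of_le' tendsto_const_nhds h1
      (Eventually.of_forall fun n => by positivity) ?_
    filter_upwards [eventually_gt_atTop 0] with n hn
    have hn' : (0 : ℝ) < n := by exact_mod_cast hn
    have h2 : (q n : ℝ) ≤ (n : ℝ) ^ (1 / 4 : ℝ) + 1 := (Nat.ceil_lt_add_one (by positivity)).le
    rw [div_le_iff₀ (by positivity), Real.sqrt_eq_rpow, add_mul, ← Real.rpow_add hn',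
      ← Real.rpow_add hn']
    norm_num
    norm_num at h2
    exact h2
  have hMlim : Tendsto (fun n : ℕ => (M n : ℝ) / √n) atTop (𝓝 0) := by
    refine tendsto_of_tendsto_of_tendsto_of_le_of_le tendsto_const_nhds
      (by simpa using hmlim.add hqlim) (fun n => by positivity) fun n => ?_
    rw [← add_div]
    gcongr
    have : M n ≤ m n + q n := max_le_add_of_nonneg (Nat.zero_le _) (Nat.zero_le _)
    rw [← Nat.cast_add]
    exact Nat.cast_le.2 this
  have hMn0 : Tendsto (fun n : ℕ => (M n : ℝ) / n) atTop (𝓝 0) := by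
    refine tendsto_of_tendsto_of_tendsto_of_le_of_le' tendsto_const_nhds hMlim
      (Eventually.of_forall fun n => by positivity) ?_
    filter_upwards [eventually_gt_atTop 0] with n hn
    have hn' : (1 : ℝ) ≤ n := by exact_mod_cast hn
    gcongr
    rw [Real.sqrt_le_left (by positivity)]
    nlinarith
  have hexp : ∀ n : ℕ, n * Real.exp (-√(M n)) ≤
      n * Real.exp (-(1 * (n : ℝ) ^ (1 / 8 : ℝ))) := fun n => by
    gcongr
    rw [one_mul]
    apply Real.le_sqrt_of_sq_le
    rw [← Real.rpow_natCast, ← Real.rpow_mul (by positivity)]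
    norm_num
    refine (Nat.le_ceil _).trans ?_
    exact_mod_cast le_max_right (m n) (q n)
  have hexp0 := tendsto_nat_mul_exp_neg_rpow (a := 1 / 8) (c := 1) (by norm_num) one_pos
  refine tendsto_of_tendsto_of_tendsto_of_le_of_le' tendsto_const_nhds hexp0
    (Eventually.of_forall fun n => measureReal_nonneg) ?_
  filter_upwards [eventually_measure_exists_row_lt hMn hMn0 one_pos, eventually_gt_atTop 0,
    hexp0.eventually_lt_const one_pos, hMlim.eventually_lt_const (half_pos hε)] with n h1 hn h2 h3
  have : Nonempty (Fin n) := ⟨⟨0, hn⟩⟩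
  rcases h1 with h1 | h1
  · linarith [hexp n]
  · refine le_trans (measureReal_mono fun ω (hω : ε < _) => ?_) (h1.le.trans (hexp n))
    obtain ⟨i, hi⟩ := exists_lt_of_lt_ciSup hω
    refine ⟨i, ?_⟩
    have h4 := norm_F_mono (le_max_left (m n) (q n)) ω i
    have h5 := div_sqrt_two_mul_le (M n) n
    have h6 := le_abs_self (‖F (M n) ω i‖ - M n / √(2 * n))
    change ‖F (m n) ω i‖ ≤ ‖F (M n) ω i‖ at h4
    linarith

/-- If `m > c * √n`, then `m` is large enough for the exponential bound to be effective, and a sample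
point exists at which both a row is longer than a multiple of `c` and `supF` is small. -/
theorem isLittleO_of_tendsto_supF {m : ℕ → ℕ} (hmn : ∀ n, m n ≤ n)
    (hm : Tendsto (fun n : ℕ => (m n : ℝ) / (n : ℝ)) atTop (𝓝 0))
    (h : ∀ ε : ℝ, 0 < ε →
      Tendsto (fun n : ℕ => (gaussianMeasure n).real {ω | ε < supF (m n) ω}) atTop (𝓝 0)) :
    (fun n : ℕ => (m n : ℝ)) =o[atTop] (fun n : ℕ => √(n : ℝ)) := by
  rw [isLittleO_iff]
  intro c hc
  have hexp0 := tendsto_nat_mul_exp_neg_rpow (a := 1 / 4) (c := √c) (by norm_num)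
    (Real.sqrt_pos.2 hc)
  filter_upwards [eventually_measure_exists_row_lt hmn hm (show (0 : ℝ) < 1 / 4 by norm_num),
    eventually_gt_atTop 0, hexp0.eventually_lt_const (show (0 : ℝ) < 1 / 2 by norm_num),
    (h (c / 8) (by positivity)).eventually_lt_const (show (0 : ℝ) < 1 / 2 by norm_num)]
    with n h1 hn h2 h3
  have hn' : (0 : ℝ) < n := by exact_mod_cast hn
  rw [Real.norm_of_nonneg (by positivity), Real.norm_of_nonneg (by positivity)]
  by_contra! hlt
  have h4 : n * Real.exp (-√(m n)) ≤ n * Real.exp (-(√c * (n : ℝ) ^ (1 / 4 : ℝ))) := by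
    gcongr
    apply Real.le_sqrt_of_sq_le
    rw [mul_pow, Real.sq_sqrt hc.le, ← Real.rpow_natCast ((n : ℝ) ^ (1 / 4 : ℝ)),
      ← Real.rpow_mul (by positivity)]
    rw [Real.sqrt_eq_rpow] at hlt
    norm_num at hlt ⊢
    exact hlt.le
  rcases h1 with h1 | h1
  · linarith
  · have h5 : (gaussianMeasure n).real Set.univ ≤ (gaussianMeasure n).real
          {ω | ∃ i, 1 / 4 * (m n / √n) < |‖F (m n) ω i‖ - m n / √(2 * n)|} +
        (gaussianMeasure n).real {ω | c / 8 < supF (m n) ω} := by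
      refine le_trans (measureReal_mono fun ω _ => ?_) (measureReal_union_le _ _)
      by_cases hω : |‖F (m n) ω ⟨0, hn⟩‖ - m n / √(2 * n)| ≤ 1 / 4 * (m n / √n)
      · right
        have h6 := norm_F_le_supF (m n) ω ⟨0, hn⟩
        have h7 := half_mul_le_div_sqrt_two_mul (m n) n
        have h8 : c < m n / √n := by rwa [lt_div_iff₀ (by positivity)]
        have h9 := (abs_le.1 hω).1
        change c / 8 < _
        linarith
      · exact Or.inl ⟨_, not_le.1 hω⟩
    rw [probReal_univ] at h5
    linarith

end Asymptotic

end GaussianGramSchmidt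

theorem corollary1p2 :
    (∃ k C : ℝ, 0 < k ∧ 0 < C ∧
      ∀ m : ℕ → ℕ, (∀ n, m n ≤ n) →
        Tendsto (fun n : ℕ => (m n : ℝ) / (n : ℝ)) atTop (𝓝 0) →
        ∃ r : ℕ → ℝ,
          r =o[atTop] (fun n : ℕ => (m n : ℝ) / √(n : ℝ)) ∧
          ∀ n : ℕ, 1 ≤ n →
            1 - C * n * Real.exp (-((m n : ℝ) ^ k)) <
              (GaussianGramSchmidt.gaussianMeasure n).real
                {ω | GaussianGramSchmidt.supF (m n) ω ≤ (m n : ℝ) / √(2 * (n : ℝ)) + r n} ∧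
            1 - C * n * Real.exp (-((m n : ℝ) ^ k)) <
              (GaussianGramSchmidt.gaussianMeasure n).real
                {ω | (m n : ℝ) / √(2 * (n : ℝ)) - r n ≤ GaussianGramSchmidt.infF (m n) ω}) ∧
    (∀ m : ℕ → ℕ, (∀ n, m n ≤ n) →
      Tendsto (fun n : ℕ => (m n : ℝ) / (n : ℝ)) atTop (𝓝 0) →
      ((∀ ε : ℝ, 0 < ε →
          Tendsto (fun n : ℕ => (GaussianGramSchmidt.gaussianMeasure n).real
            {ω | ε < GaussianGramSchmidt.supF (m n) ω}) atTop (𝓝 0)) ↔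
        (fun n : ℕ => (m n : ℝ)) =o[atTop] (fun n : ℕ => √(n : ℝ)))) := by
  -- The exponent is `k = 1 / 2` and the constant is `C = 1`.
  refine ⟨⟨1 / 2, 1, by norm_num, one_pos, fun m hmn hm => ?_⟩, fun m hmn hm =>
    ⟨GaussianGramSchmidt.isLittleO_of_tendsto_supF hmn hm, fun ho ε hε =>
      GaussianGramSchmidt.tendsto_supF_of_isLittleO hmn ho hε⟩⟩
  obtain ⟨r, hr, h⟩ := GaussianGramSchmidt.exists_isLittleO_normBounds hmn hm
  refine ⟨r, hr, fun n hn => ?_⟩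
  rw [one_mul, ← Real.sqrt_eq_rpow]
  exact h n hn
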